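/- All groups are finite. For a group $G$ let $\Phi(G)$ denote its Frattini subgroup, the intersection of all maximal subgroups of $G$; $G$ is Frattini-free if $\Phi(G)=1$, and cube-free if $q^3\nmid |G|$ for every prime $q$. Let $C_n$ be the cyclic group of order $n$. Let $Y$ be a solvable Frattini-free group and let $Y^\ast$ be a cube-free Frattini extension of $Y$, that is, a cube-free group with $Y^\ast/\Phi(Y^\ast)\cong Y$. Let $p$ be a prime, and let $Y_p$ and $Y^\ast_p$ be Sylow $p$-subgroups of $Y$ and $Y^\ast$, respectively. If $p\nmid|\Phi(Y^\ast)|$, then $Y^\ast_p\cong Y_p$. If $p\mid|\Phi(Y^\ast)|$, then $Y_p\cong C_p$ and $Y^\ast_p\cong C_{p^2}$. -/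

import Mathlib

/-- A finite group `G` is cube-free if no prime to the third power divides `|G|`. -/
def IsCubeFreeGroup (G : Type*) [Group G] : Prop :=
  Finite G ∧ ∀ q : ℕ, q.Prime → ¬ q ^ 3 ∣ Nat.card G

/-- A group is Frattini-free if its Frattini subgroup is trivial. -/
def IsFrattiniFree (G : Type*) [Group G] : Prop :=
  frattini G = ⊥

/-- `E` is a Frattini extension of (the Frattini-free group) `Y` if `E / Φ(E) ≅ Y`. -/
def IsFrattiniExtension (E Y : Type*) [Group E] [Group Y] : Prop :=
  Nonempty ((E ⧸ frattini E) ≃* Y)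

open Subgroup

/-! ### Gaschütz' theorem via transfer -/

section Gaschutz

open scoped IsMulCommutative

variable {G : Type*} [Group G]

/-! A nontrivial normal subgroup inside the Frattini subgroup has no complement in G. By Gaschütz,
it then has none in an abelian Sylow subgroup P containing it. Apply this to the Sylow p-subgroup N
of Φ(G), normal in G by the Frattini argument. If N ≠ 1, cube-freeness makes P abelian and leaves
only |N| = p, |P| = p², with P cyclic, since otherwise N would split off P. If p ∤ |Φ(G)|, the
quotient map is injective on P. -/

theorem MulAut.conjNormal_eq_self_of_mem_centralizer {N : Subgroup G} [N.Normal] {g : G}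
    (hg : g ∈ centralizer (N : Set G)) (n : N) : MulAut.conjNormal g n = n := by
  ext
  rw [MulAut.conjNormal_apply, ← mem_centralizer_iff.mp hg n n.2, mul_inv_cancel_right]

/-- The conjugate `x ↦ g⁻¹ f(g x g⁻¹) g` of a homomorphism between normal subgroups. -/
def MonoidHom.conjTwist {C N : Subgroup G} [C.Normal] [N.Normal] (f : C →* N) (g : G) : C →* N :=
  ((MulAut.conjNormal g⁻¹ : MulAut N).toMonoidHom.comp f).comp
    (MulAut.conjNormal g : MulAut C).toMonoidHom

theorem MonoidHom.conjTwist_apply {C N : Subgroup G} [C.Normal] [N.Normal] (f : C →* N) (g : G)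
    (x : C) : f.conjTwist g x = MulAut.conjNormal g⁻¹ (f (MulAut.conjNormal g x)) := rfl

theorem MonoidHom.conjTwist_conj {C N : Subgroup G} [C.Normal] [N.Normal] (f : C →* N) (a g : G)
    (x : C) : f.conjTwist a (MulAut.conjNormal g x) =
      MulAut.conjNormal g (f.conjTwist (a * g) x) := by
  simp only [MonoidHom.conjTwist_apply, ← MulAut.mul_apply, ← map_mul]
  congr 2
  group

/-- Inner automorphisms of the centralizer are invisible to a map into abelian N, and the
centralizer acts trivially on N. Hence the twist depends only on the coset. -/
theorem MonoidHom.conjTwist_mul_of_mem {N : Subgroup G} [N.Normal] [IsMulCommutative N]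
    (f : centralizer (N : Set G) →* N) {a k : G} (hk : k ∈ centralizer (N : Set G)) :
    f.conjTwist (a * k) = f.conjTwist a := by
  ext1 x
  have hak : a * k * a⁻¹ ∈ centralizer (N : Set G) :=
    (inferInstance : (centralizer (N : Set G)).Normal).conj_mem k hk a
  have key : MulAut.conjNormal (a * k) x =
      (⟨_, hak⟩ : centralizer (N : Set G)) * MulAut.conjNormal a x * ⟨_, hak⟩⁻¹ := by
    ext
    simp only [MulAut.conjNormal_apply, Subgroup.coe_mul, Subgroup.coe_inv]
    group
  rw [conjTwist_apply, conjTwist_apply, key, map_mul f, map_mul f, map_inv f,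
    mul_inv_cancel_comm, mul_inv_rev, map_mul, MulAut.mul_apply]
  exact MulAut.conjNormal_eq_self_of_mem_centralizer (inv_mem hk) _

/-- Averaging a homomorphism `C_G(N) → N` over `G / C_G(N)` makes it `G`-equivariant. -/
theorem exists_equivariant_hom_of_centralizer [Finite G] {N : Subgroup G} [N.Normal]
    [IsMulCommutative N] (f : centralizer (N : Set G) →* N) {m : ℕ}
    (hf : ∀ x : centralizer (N : Set G), (x : G) ∈ N → (f x : G) = (x : G) ^ m) :
    ∃ F : centralizer (N : Set G) →* N,
      (∀ (g : G) (x : centralizer (N : Set G)),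
        F (MulAut.conjNormal g x) = MulAut.conjNormal g (F x)) ∧
      ∀ x : centralizer (N : Set G), (x : G) ∈ N →
        (F x : G) = (x : G) ^ (m * (centralizer (N : Set G)).index) := by
  classical
  have := Fintype.ofFinite (G ⧸ centralizer (N : Set G))
  refine ⟨∏ q : G ⧸ centralizer (N : Set G), f.conjTwist q.out, fun g x => ?_, fun x hx => ?_⟩
  · simp only [MonoidHom.finsetProd_apply, map_prod, MonoidHom.conjTwist_conj]
    -- Conjugation by `g` permutes the cosets; the change of representative lies in the centralizer.
    refine Fintype.prod_equiv (Equiv.mulRight (g : G ⧸ centralizer (N : Set G))) _ _ fun q => ?_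
    have hq : ((q.out * g : G) : G ⧸ centralizer (N : Set G)) = q * g := by
      rw [QuotientGroup.mk_mul, QuotientGroup.out_eq']
    obtain ⟨k, hk⟩ := QuotientGroup.mk_out_eq_mul (centralizer (N : Set G)) (q.out * g)
    rw [show Equiv.mulRight (g : G ⧸ centralizer (N : Set G)) q = _ from hq.symm, hk,
      MonoidHom.conjTwist_mul_of_mem f k.2]
  · have h (a : G) : f.conjTwist a x = ⟨x, hx⟩ ^ m := by
      ext
      have hax : ((MulAut.conjNormal a x : centralizer (N : Set G)) : G) ∈ N :=
        (inferInstance : N.Normal).conj_mem _ hx a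
      rw [MonoidHom.conjTwist_apply, MulAut.conjNormal_apply, hf _ hax, MulAut.conjNormal_apply,
        conj_pow, SubgroupClass.coe_pow]
      group
    rw [MonoidHom.finsetProd_apply, Finset.prod_congr rfl fun q _ => h q.out, Finset.prod_const,
      Finset.card_univ, ← Nat.card_eq_fintype_card, ← Subgroup.index, ← pow_mul,
      SubgroupClass.coe_pow]

/-- **Gaschütz' theorem** for an abelian Sylow subgroup: a normal subgroup that is a retract of an
abelian Sylow subgroup `P` is complemented in the whole group. -/
theorem Sylow.exists_isCompl_of_retraction [Finite G] {p : ℕ} [Fact p.Prime] (P : Sylow p G)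
    [IsMulCommutative P] {N : Subgroup G} [N.Normal] (hNP : N ≤ P) (r : P →* N)
    (hr : ∀ x : P, (x : G) ∈ N → (r x : G) = x) : ∃ H : Subgroup G, IsCompl N H := by
  have hPcomm {x y : G} (hx : x ∈ P) (hy : y ∈ P) : x * y = y * x :=
    congrArg Subtype.val (mul_comm' (⟨x, hx⟩ : P) ⟨y, hy⟩)
  have : IsMulCommutative N :=
    ⟨⟨fun a b => Subtype.ext (hPcomm (hNP a.2) (hNP b.2))⟩⟩
  set C := centralizer (N : Set G)
  have hPC : (P : Subgroup G) ≤ C := fun x hx =>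
    mem_centralizer_iff.mpr fun n hn => hPcomm (hNP hn) hx
  have hNC : N ≤ C := hNP.trans hPC
  let φ : (P : Subgroup G).subgroupOf C →* N := r.comp (subgroupOfEquivOfLe hPC).toMonoidHom
  -- N is central in `C`, so the transfer of `r` to `C` is the power map by [C : P] on N.
  obtain ⟨F, hFG, hFN⟩ := exists_equivariant_hom_of_centralizer φ.transfer
    (m := ((P : Subgroup G).subgroupOf C).index) fun x hx => by
      rw [MonoidHom.transfer_eq_pow]
      · exact hr _ (N.pow_mem hx _)
      · intro k g _
        have hg : Commute (x ^ k) g :=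
          Commute.pow_left (Subtype.ext (mem_centralizer_iff.mp g.2 x hx)) k
        rw [mul_assoc, hg.eq, inv_mul_cancel_left]
  set m := ((P : Subgroup G).subgroupOf C).index * C.index
  have hNp : IsPGroup p N := P.2.to_le hNP
  have hmp : ¬ p ∣ m := by
    have : m = (P : Subgroup G).index := relIndex_mul_index hPC
    rw [this]
    exact P.not_dvd_index
  have hCp : ¬ p ∣ C.index := fun h => hmp (h.mul_left _)
  have hcop {k : ℕ} (hk : ¬ p ∣ k) : (Nat.card N).Coprime k := by
    obtain ⟨n, hn⟩ := IsPGroup.iff_card.mp hNp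
    rw [hn]
    exact Nat.Coprime.pow_left n ((Nat.Prime.coprime_iff_not_dvd Fact.out).mpr hk)
  -- As `F` is bijective on N (p ∤ m), its kernel complements N in `C`; equivariance makes it normal
  -- in G.
  let K : Subgroup G := F.ker.map C.subtype
  have hK : K.Normal := by
    refine ⟨?_⟩
    rintro _ ⟨x, hx, rfl⟩ g
    refine ⟨MulAut.conjNormal g x, ?_, rfl⟩
    rw [SetLike.mem_coe, MonoidHom.mem_ker] at hx ⊢
    rw [hFG, hx, map_one]
  have hKN {x : G} (hxK : x ∈ K) (hxN : x ∈ N) : x = 1 := by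
    obtain ⟨y, hy, rfl⟩ := hxK
    have h1 : (y : G) ^ m = 1 := by
      rw [← hFN y hxN, MonoidHom.mem_ker.mp hy, Subgroup.coe_one]
    have h2 : (⟨y, hxN⟩ : N) = 1 := by
      apply (powCoprime (hcop hmp)).injective
      ext
      simpa [powCoprime] using h1
    exact congrArg Subtype.val h2
  have hCKN : C ≤ K ⊔ N := by
    intro c hc
    obtain ⟨n, hn⟩ := (powCoprime (hcop hmp)).surjective (F ⟨c, hc⟩)
    have hFn : F ⟨n, hNC n.2⟩ = F ⟨c, hc⟩ := by
      rw [← hn]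
      ext
      exact hFN _ n.2
    have hmem : c * (n : G)⁻¹ ∈ K := by
      refine ⟨⟨c, hc⟩ * ⟨n, hNC n.2⟩⁻¹, ?_, rfl⟩
      rw [SetLike.mem_coe, MonoidHom.mem_ker, map_mul, map_inv, hFn, mul_inv_cancel]
    simpa using mul_mem_sup hmem n.2
  have hKC : K ≤ C := map_subtype_le _
  have hsurj : Function.Surjective (QuotientGroup.mk' K) := QuotientGroup.mk'_surjective K
  have hCmap : C.map (QuotientGroup.mk' K) = N.map (QuotientGroup.mk' K) := by
    refine le_antisymm ?_ (map_mono hNC)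
    refine (map_mono hCKN).trans ?_
    rw [Subgroup.map_sup, (Subgroup.map_eq_bot_iff K).mpr (QuotientGroup.ker_mk' K).ge, bot_sup_eq]
  have hCnormal : (C.map (QuotientGroup.mk' K)).Normal :=
    (inferInstance : C.Normal).map _ hsurj
  -- Modulo `K`, `C` becomes the p-group image of N, of index prime to p: Schur–Zassenhaus applies.
  have hSZ : (Nat.card (C.map (QuotientGroup.mk' K))).Coprime
      (C.map (QuotientGroup.mk' K)).index := by
    rw [index_map_eq C hsurj (by rwa [QuotientGroup.ker_mk']), hCmap]
    exact (hcop hCp).coprime_dvd_left (card_map_dvd _ _)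
  obtain ⟨H, hH⟩ := exists_right_complement'_of_coprime hSZ
  refine ⟨H.comap (QuotientGroup.mk' K), disjoint_iff_inf_le.mpr ?_, codisjoint_iff.mpr ?_⟩
  · rintro x ⟨hxN, hxH⟩
    refine hKN ((QuotientGroup.eq_one_iff x).mp ?_) hxN
    exact (disjoint_def.mp hH.disjoint) (mem_map_of_mem _ (hNC hxN)) hxH
  · have hle : K ≤ N ⊔ H.comap (QuotientGroup.mk' K) := by
      refine le_sup_of_le_right fun x hx => ?_
      have h1 : QuotientGroup.mk' K x = 1 := (QuotientGroup.eq_one_iff x).mpr hx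
      exact mem_comap.mpr (h1.symm ▸ one_mem H)
    rw [← comap_map_eq_self ((QuotientGroup.ker_mk' K).trans_le hle), Subgroup.map_sup,
      map_comap_eq_self_of_surjective hsurj, ← hCmap, hH.sup_eq_top, comap_top]

end Gaschutz

/-! ### Sylow subgroups and the Frattini subgroup -/

section Frattini

variable {G : Type*} [Group G] [Finite G]

theorem eq_bot_of_isCompl_of_le_frattini {N H : Subgroup G} (hN : N ≤ frattini G)
    (h : IsCompl N H) : N = ⊥ := by
  have hH : H = ⊤ := frattini_nongenerating
    (top_le_iff.mp (h.sup_eq_top.ge.trans (sup_comm N H ▸ sup_le_sup_left hN H)))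
  simpa [hH] using h.inf_eq_bot

theorem Sylow.normal_map_subtype_frattini {p : ℕ} [Fact p.Prime] (S : Sylow p (frattini G)) :
    ((S : Subgroup (frattini G)).map (frattini G).subtype).Normal :=
  normalizer_eq_top_iff.mp (frattini_nongenerating S.normalizer_sup_eq_top)

/-- A nontrivial normal subgroup inside the Frattini subgroup is not complemented in an abelian
Sylow subgroup containing it. -/
theorem Sylow.not_isCompl_of_le_frattini {p : ℕ} [Fact p.Prime] (P : Sylow p G)
    [IsMulCommutative P] {N : Subgroup G} [N.Normal] (hNP : N ≤ P) (hN : N ≤ frattini G)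
    (hbot : N ≠ ⊥) (L : Subgroup P) : ¬ IsCompl (N.subgroupOf P) L := by
  intro hL
  have hcomm (x y : P) : x * y = y * x := mul_comm' x y
  have : L.Normal := ⟨fun x hx g => by rwa [hcomm g x, mul_inv_cancel_right]⟩
  let e : N.subgroupOf P ≃* P ⧸ L :=
    MulEquiv.ofBijective ((QuotientGroup.mk' L).comp (N.subgroupOf P).subtype) <| by
      constructor
      · rw [injective_iff_map_eq_one]
        intro x hx
        exact Subtype.ext (disjoint_def.mp hL.disjoint x.2 ((QuotientGroup.eq_one_iff _).mp hx))
      · intro q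
        obtain ⟨x, rfl⟩ := QuotientGroup.mk'_surjective L q
        have hx : x ∈ N.subgroupOf P ⊔ L := hL.sup_eq_top ▸ mem_top x
        obtain ⟨y, hy, z, hz, rfl⟩ := mem_sup_of_normal_right.mp hx
        refine ⟨⟨y, hy⟩, ?_⟩
        simp [(QuotientGroup.eq_one_iff z).mpr hz]
  let r : P →* N := (subgroupOfEquivOfLe hNP).toMonoidHom.comp
    (e.symm.toMonoidHom.comp (QuotientGroup.mk' L))
  obtain ⟨H, hH⟩ := P.exists_isCompl_of_retraction hNP r fun x hx => by
    have : e.symm (QuotientGroup.mk' L x) = ⟨x, hx⟩ := e.symm_apply_eq.mpr rfl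
    change ((subgroupOfEquivOfLe hNP (e.symm (QuotientGroup.mk' L x)) : N) : G) = x
    rw [this]
    rfl
  exact hbot (eq_bot_of_isCompl_of_le_frattini hN hH)

/-- If `p` divides the order of the Frattini subgroup and `|G|` is not divisible by `p ^ 3`, then
the Sylow `p`-subgroups are cyclic of order `p ^ 2`, with Frattini part of order `p`. -/
theorem Sylow.isCyclic_of_dvd_card_frattini {p : ℕ} [hp : Fact p.Prime] (P : Sylow p G)
    (h3 : ¬ p ^ 3 ∣ Nat.card G) (hdvd : p ∣ Nat.card (frattini G)) :
    IsCyclic P ∧ Nat.card P = p ^ 2 ∧ (Nat.card (frattini G)).factorization p = 1 := by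
  obtain ⟨S⟩ : Nonempty (Sylow p (frattini G)) := inferInstance
  set N := (S : Subgroup (frattini G)).map (frattini G).subtype
  have : N.Normal := S.normal_map_subtype_frattini
  have hNp : IsPGroup p N := S.2.map _
  have hNP : N ≤ P := hNp.le_sylow_of_normal P
  have hNF : N ≤ frattini G := map_subtype_le _
  have hcardN : Nat.card N = p ^ (Nat.card (frattini G)).factorization p := by
    rw [← S.card_eq_multiplicity]
    exact card_map_of_injective (frattini G).subtype_injective
  have hpos : 1 ≤ (Nat.card (frattini G)).factorization p :=
    (hp.out.dvd_iff_one_le_factorization Nat.card_pos.ne').mp hdvd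
  have hNbot : N ≠ ⊥ := by
    rw [Ne, ← card_eq_one, hcardN]
    exact (Nat.one_lt_pow (by omega) hp.out.one_lt).ne'
  have hcardP := P.card_eq_multiplicity
  have hle2 : (Nat.card G).factorization p ≤ 2 := by
    by_contra! h
    exact h3 ((pow_dvd_pow p h).trans (Nat.ordProj_dvd _ _))
  have hPN : (Nat.card (frattini G)).factorization p ≤ (Nat.card G).factorization p := by
    have := card_le_of_le hNP
    rw [hcardN, hcardP] at this
    exact (Nat.pow_le_pow_iff_right hp.out.one_lt).mp this
  have : IsMulCommutative P := by
    obtain h | h : (Nat.card G).factorization p = 1 ∨ (Nat.card G).factorization p = 2 := by omega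
    · have : IsCyclic P := isCyclic_of_prime_card (hcardP.trans (by rw [h, pow_one]))
      infer_instance
    · exact IsPGroup.isMulCommutative_of_card_eq_prime_sq (hcardP.trans (by rw [h]))
  have hlt : (Nat.card (frattini G)).factorization p < (Nat.card G).factorization p := by
    refine lt_of_le_of_ne hPN fun h => ?_
    have hNeq : N = P := eq_of_le_of_card_ge hNP (by rw [hcardN, hcardP, h])
    -- If N = P, the trivial subgroup would be a complement.
    refine P.not_isCompl_of_le_frattini hNP hNF hNbot ⊥ ?_
    rw [hNeq, subgroupOf_self]
    exact isCompl_top_bot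
  have hG : (Nat.card G).factorization p = 2 := by omega
  have hF : (Nat.card (frattini G)).factorization p = 1 := by omega
  rw [hG] at hcardP
  rw [hF, pow_one] at hcardN
  refine ⟨?_, hcardP, hF⟩
  by_contra hcyc
  have hcardN' : Nat.card (N.subgroupOf P) = p :=
    (Nat.card_congr (subgroupOfEquivOfLe hNP).toEquiv).trans hcardN
  -- In a noncyclic group of order p², any `x` outside N generates a complement of order p.
  obtain ⟨x, hx⟩ : ∃ x : P, x ∉ N.subgroupOf P := by
    by_contra! h
    have := (eq_top_iff' _).mpr h
    rw [this, card_top, hcardP] at hcardN'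
    exact absurd (Nat.pow_right_injective hp.out.two_le (hcardN'.trans (pow_one p).symm))
      (by decide)
  have hxp : Nat.card (zpowers x) = p := by
    have hd : Nat.card (zpowers x) ∣ p ^ 2 := hcardP ▸ card_subgroup_dvd_card _
    obtain ⟨k, hk, hxk⟩ := (Nat.dvd_prime_pow hp.out).mp hd
    interval_cases k
    · rw [pow_zero, Nat.card_zpowers, orderOf_eq_one_iff] at hxk
      exact absurd (hxk ▸ one_mem _) hx
    · rw [hxk, pow_one]
    · exact absurd (isCyclic_of_orderOf_eq_card x 
        ((Nat.card_zpowers x).symm.trans (hxk.trans hcardP.symm))) hcyc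
  have hdisj : Disjoint (N.subgroupOf P) (zpowers x) := by
    rw [disjoint_iff]
    have hd : Nat.card (N.subgroupOf P ⊓ zpowers x : Subgroup P) ∣ p := by
      conv_rhs => rw [← hxp]
      exact card_dvd_of_le inf_le_right
    rcases (Nat.dvd_prime hp.out).mp hd with h | h
    · exact card_eq_one.mp h
    · have := eq_of_le_of_card_ge (inf_le_right : N.subgroupOf P ⊓ zpowers x ≤ _) (hxp.trans h.symm).le
      exact absurd (inf_eq_right.mp this (mem_zpowers x)) hx
  have hcompl : IsComplement' (N.subgroupOf P) (zpowers x) :=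
    isComplement'_of_card_mul_and_disjoint
      ((congrArg₂ (· * ·) hcardN' hxp).trans (hcardP.trans (sq p)).symm) hdisj
  exact P.not_isCompl_of_le_frattini hNP hNF hNbot _ hcompl.isCompl

end Frattini

/-- A surjective homomorphism whose kernel has order prime to `p` induces an isomorphism on Sylow
`p`-subgroups. -/
theorem Sylow.nonempty_mulEquiv_of_surjective {G H : Type*} [Group G] [Group H] [Finite G]
    {p : ℕ} [hp : Fact p.Prime] {f : G →* H} (hf : Function.Surjective f)
    (hker : ¬ p ∣ Nat.card f.ker) (P : Sylow p G) (Q : Sylow p H) : Nonempty (P ≃* Q) := by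
  have : Finite H := Finite.of_surjective f hf
  have hinj : Function.Injective (f.comp (P : Subgroup G).subtype) := by
    rw [injective_iff_map_eq_one]
    intro x hx
    obtain ⟨k, hk⟩ := P.2 x
    have h1 : orderOf x ∣ p ^ k := orderOf_dvd_of_pow_eq_one hk
    have h2 : orderOf x ∣ Nat.card f.ker := by
      rw [← orderOf_coe]
      exact (orderOf_mk (x : G) (f.mem_ker.mpr hx)).symm.dvd.trans (orderOf_dvd_natCard _)
    rw [← orderOf_eq_one_iff]
    exact Nat.eq_one_of_dvd_coprimes
      (Nat.Coprime.pow_left k ((Nat.Prime.coprime_iff_not_dvd hp.out).mpr hker)) h1 h2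
  have e₁ : P ≃* (P.mapSurjective hf : Subgroup H) :=
    (MonoidHom.ofInjective hinj).trans (MulEquiv.subgroupCongr (by
      rw [MonoidHom.range_comp, range_subtype]; rfl))
  exact ⟨e₁.trans ((P.mapSurjective hf).equiv Q)⟩

theorem mainTheorem12 {Y Ystar : Type*} [Group Y] [Group Ystar] [Finite Y]
    (hYsolv : Group.IsSolvable Y) (hYfree : IsFrattiniFree Y)
    (hcube : IsCubeFreeGroup Ystar) (hext : IsFrattiniExtension Ystar Y)
    (p : ℕ) (hp : p.Prime) :
    (¬ p ∣ Nat.card (frattini Ystar) →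
      ∀ (P : Sylow p Ystar) (Q : Sylow p Y), Nonempty (P ≃* Q)) ∧
    (p ∣ Nat.card (frattini Ystar) →
      ∀ (P : Sylow p Ystar) (Q : Sylow p Y),
        Nonempty (Q ≃* Multiplicative (ZMod p)) ∧
        Nonempty (P ≃* Multiplicative (ZMod (p ^ 2)))) := by
  have : Fact p.Prime := ⟨hp⟩
  have : Finite Ystar := hcube.1
  obtain ⟨e⟩ := hext
  refine ⟨fun hndvd P Q => ?_, fun hdvd P Q => ?_⟩
  · let f : Ystar →* Y := e.toMonoidHom.comp (QuotientGroup.mk' (frattini Ystar))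
    have hker : f.ker = frattini Ystar := by
      exact (MonoidHom.ker_mulEquiv_comp _ e).trans (QuotientGroup.ker_mk' _)
    exact Sylow.nonempty_mulEquiv_of_surjective (f := f)
      (e.surjective.comp (QuotientGroup.mk'_surjective _)) (by rwa [hker]) P Q
  · obtain ⟨hcyc, hcard, hF⟩ := P.isCyclic_of_dvd_card_frattini (hcube.2 p hp) hdvd
    have hcardY : Nat.card Y = Nat.card (Ystar ⧸ frattini Ystar) := Nat.card_congr e.symm.toEquiv
    have hfac : (Nat.card Ystar).factorization p = 2 :=
      Nat.pow_right_injective hp.two_le (P.card_eq_multiplicity.symm.trans hcard)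
    -- Comparing exponents of p in |Y*| = |Y|·|Φ(Y*)| gives 2 = 1 + 1.
    rw [card_eq_card_quotient_mul_card_subgroup (frattini Ystar), ← hcardY,
      Nat.factorization_mul Nat.card_pos.ne' Nat.card_pos.ne', Finsupp.add_apply, hF] at hfac
    have hQ : Nat.card Q = p := by
      rw [Q.card_eq_multiplicity, show (Nat.card Y).factorization p = 1 by omega, pow_one]
    have : IsCyclic Q := isCyclic_of_prime_card hQ
    exact ⟨⟨mulEquivOfCyclicCardEq (hQ.trans (Nat.card_zmod p).symm)⟩,
      ⟨mulEquivOfCyclicCardEq (hcard.trans (Nat.card_zmod (p ^ 2)).symm)⟩⟩
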